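/- Fix a field $\Bbbk$ and an integer $n \ge 1$, and give $\mathbb{R}^n$ the product order. A persistence module is a functor $M \colon \mathbb{R}^n \to \mathrm{vec}$ to finite dimensional $\Bbbk$-vector spaces, with structure morphisms $\varphi^M_{r,s} \colon M(r) \to M(s)$ for $r \le s$. For $i < j$ with $i \in \mathbb{R}^n$ and $j \in \mathbb{R}^n \cup \{\infty\}$, the hook module $\mathsf{L}_{i,j}$ is $\Bbbk$ on $\{a \in \mathbb{R}^n : a \ge i,\ a \not\ge j\}$ and $0$ elsewhere, with identity structure morphisms inside this set. The barcode $\mathcal{B}(M)$ of a persistence module $M$ is the multiset of isomorphism classes of the summands in a decomposition of $M$ as a direct sum of indecomposables (it does not depend on the decomposition). For a real number $\epsilon \ge 0$, write $M[\epsilon](r) = M(r + (\epsilon,\dots,\epsilon))$. Persistence modules $M, N$ are $\epsilon$-interleaved if there are morphisms $f \colon M \to N[\epsilon]$ and $g \colon N \to M[\epsilon]$ such that $g[\epsilon] \circ f$ and $f[\epsilon]\circ g$ are the morphisms $M \to M[2\epsilon]$ and $N \to N[2\epsilon]$ given by the structure morphisms. An $\epsilon$-matching between barcodes $\{[M_i]\}_{i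 \in I}$ and $\{[N_j]\}_{j \in J}$ is a bijection $h$ from a subset of $I$ to a subset of $J$ such that $M_i$ and $N_{h(i)}$ are $\epsilon$-interleaved for every $i$ in the domain of $h$, and every $M_i$ with $i$ not in the domain of $h$ and every $N_j$ with $j$ not in the image of $h$ is $\epsilon$-interleaved with the zero module. **Theorem.** Let $P, Q \colon \mathbb{R}^n \to \mathrm{vec}$ be persistence modules that decompose as countable direct sums of hook modules, and let $\epsilon \ge 0$. If $P$ and $Q$ are $\epsilon$-interleaved, then there exists a $(2n-1)\epsilon$-matching between $\mathcal{B}(P)$ and $\mathcal{B}(Q)$. -/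

import Mathlib

open CategoryTheory

noncomputable section

namespace HookStability

universe u v w

/-- The poset `ℝⁿ` with its product order. (A type synonym, so that as a category it is the one
attached to this order, with one morphism `r ⟶ s` exactly when `r ≤ s`.) -/
def RPow (n : ℕ) : Type := Fin n → ℝ

namespace RPow

variable {n : ℕ}

instance : PartialOrder (RPow n) := inferInstanceAs (PartialOrder (Fin n → ℝ))

instance : AddCommGroup (RPow n) := inferInstanceAs (AddCommGroup (Fin n → ℝ))

instance : IsOrderedAddMonoid (RPow n) := inferInstanceAs (IsOrderedAddMonoid (Fin n → ℝ))

/-- The constant vector `(ε, …, ε)`. -/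
def const (n : ℕ) (ε : ℝ) : RPow n := fun _ => ε

theorem const_nonneg {ε : ℝ} (h : 0 ≤ ε) : 0 ≤ const n ε := fun _ => h

end RPow

/-- Functors from the poset `ℝⁿ` (product order) to `k`-vector spaces. -/
abbrev PersMod (k : Type u) [Field k] (n : ℕ) : Type (u + 1) :=
  RPow n ⥤ ModuleCat.{u} k

variable {k : Type u} [Field k] {n : ℕ}

/-- Pointwise finite dimensionality: the functor lands in finite dimensional spaces. -/
def IsPFD (M : PersMod k n) : Prop :=
  ∀ r : RPow n, FiniteDimensional k (M.obj r)

/-! ### Interleavings -/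

/-- The shift `M[v]`, with `M[v](r) = M(r + v)` and the structure morphisms of `M`. -/
abbrev shift (v : RPow n) (M : PersMod k n) : PersMod k n where
  obj r := M.obj (r + v)
  map {_ _} h := M.map (homOfLE (add_le_add_left (leOfHom h) v))
  map_id _ := M.map_id _
  map_comp _ _ := (M.map_comp _ _).symm ▸ rfl

/-- There are morphisms `f : M ⟶ N[v]`, `g : N ⟶ M[w]` such that both composites
`M(r) ⟶ N(r + v) ⟶ M(r + v + w)` and `N(r) ⟶ M(r + w) ⟶ N(r + w + v)` are the structure
morphisms. -/
def VecInterleaved (v w : RPow n) (hv : 0 ≤ v) (hw : 0 ≤ w) (M N : PersMod k n) : Prop :=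
  ∃ (f : M ⟶ shift v N) (g : N ⟶ shift w M),
    (∀ r : RPow n, f.app r ≫ g.app (r + v) =
      M.map (homOfLE ((le_add_of_nonneg_right hv).trans (le_add_of_nonneg_right hw)))) ∧
    (∀ r : RPow n, g.app r ≫ f.app (r + w) =
      N.map (homOfLE ((le_add_of_nonneg_right hw).trans (le_add_of_nonneg_right hv))))

/-- `M` and `N` are `ε`-interleaved, where `ε ≥ 0` is a real number; the shift is by the
constant vector `(ε, …, ε)`. -/
def Interleaved (ε : ℝ) (M N : PersMod k n) : Prop :=
  ∃ h : 0 ≤ ε, VecInterleaved (RPow.const n ε) (RPow.const n ε)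
    (RPow.const_nonneg h) (RPow.const_nonneg h) M N

/-- The zero persistence module. -/
def zeroModule (k : Type u) [Field k] (n : ℕ) : PersMod k n :=
  (Functor.const (RPow n)).obj (ModuleCat.of k PUnit.{u + 1})

/-! ### Interval modules and hook modules -/

/-- The line `k` if `r ∈ S`, the zero subspace of `k` otherwise. -/
def intervalSpace (k : Type u) [Field k] (S : Set (RPow n)) (r : RPow n) :
    Submodule k k where
  carrier := {x | r ∉ S → x = 0}
  add_mem' hx hy h := by simp [hx h, hy h]
  zero_mem' _ := rfl
  smul_mem' c x hx h := by simp [hx h]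

open Classical in
/-- The identity of `k` if the target index is in `S` (when the source index is not in `S`,
the source space is zero), and zero otherwise. -/
def intervalMap (k : Type u) [Field k] (S : Set (RPow n)) (r s : RPow n) :
    intervalSpace k S r →ₗ[k] intervalSpace k S s where
  toFun x := ⟨if s ∈ S then (x : k) else 0, fun h => by simp [h]⟩
  map_add' x y := by
    ext
    by_cases h : s ∈ S <;> simp [h]
  map_smul' c x := by
    ext
    by_cases h : s ∈ S <;> simp [h]

/-- The persistence module `k_S` of an order convex set `S`. -/
def intervalModule (k : Type u) [Field k] (S : Set (RPow n)) (hS : S.OrdConnected) :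
    PersMod k n where
  obj r := ModuleCat.of k (intervalSpace k S r)
  map {r s} _ := ModuleCat.ofHom (intervalMap k S r s)
  map_id r := by
    ext x
    by_cases h : r ∈ S
    · simp [intervalMap, h]
    · have hx : (x : k) = 0 := x.2 h
      simp [intervalMap, hx]
  map_comp {r s t} f g := by
    ext x
    by_cases ht : t ∈ S
    · by_cases hs : s ∈ S
      · simp [intervalMap, hs, ht]
      · have hr : r ∉ S := fun hr => hs (hS.out hr ht ⟨leOfHom f, leOfHom g⟩)
        have hx : (x : k) = 0 := x.2 hr
        simp [intervalMap, hx]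
    · simp [intervalMap, ht]

/-- The support `{a | i ≤ a, a ≱ j}` of a hook, where `j ∈ ℝⁿ ∪ {∞}`. -/
def hookSet (i : RPow n) (j : WithTop (RPow n)) : Set (RPow n) :=
  {a | i ≤ a ∧ ¬ j ≤ (a : WithTop (RPow n))}

theorem hookSet_ordConnected (i : RPow n) (j : WithTop (RPow n)) :
    (hookSet i j).OrdConnected :=
  ⟨fun _ ha _ hb _ hc =>
    ⟨ha.1.trans hc.1, fun h => hb.2 (h.trans (WithTop.coe_le_coe.2 hc.2))⟩⟩

/-- The interval module `L_{i,j}` supported on `{a | i ≤ a, a ≱ j}`. -/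
def hookModule (k : Type u) [Field k] (i : RPow n) (j : WithTop (RPow n)) :
    PersMod k n :=
  intervalModule k (hookSet i j) (hookSet_ordConnected i j)

/-- `M` is (isomorphic to) a hook module `L_{i,j}` with `i < j ∈ ℝⁿ ∪ {∞}`. -/
def IsHook (M : PersMod k n) : Prop :=
  ∃ (i : RPow n) (j : WithTop (RPow n)),
    (i : WithTop (RPow n)) < j ∧ Nonempty (M ≅ hookModule k i j)

/-! ### Direct sums, barcodes and matchings -/

open Classical in
/-- `P` is the direct sum of the family `M`: there are morphisms `M i ⟶ P` that identify `P`
with the (pointwise) direct sum of the `M i`. -/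
def IsDirectSum {I : Type v} (M : I → PersMod k n) (P : PersMod k n) : Prop :=
  ∃ ι : ∀ i, M i ⟶ P, ∀ r : RPow n,
    Function.Bijective
      (DirectSum.toModule k I (P.obj r) (fun i => ((ι i).app r).hom))

/-- `P` decomposes as a countable direct sum of hook modules. -/
def IsCountablyHookDecomposable (P : PersMod k n) : Prop :=
  ∃ (I : Type) (_ : Countable I) (M : I → PersMod k n),
    (∀ i, IsHook (M i)) ∧ IsDirectSum M P

/-- The family `B` represents the barcode of `P`: its members are indecomposable and `P` is
their direct sum. (The multiset of the isomorphism classes of the `B i` is determined by `P`.) -/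
def IsBarcode {I : Type v} (P : PersMod k n) (B : I → PersMod k n) : Prop :=
  (∀ i, Indecomposable (B i)) ∧ IsDirectSum B P

/-- A partial matching between index sets: a bijection from a subset of `I` to one of `J`. -/
structure PartialMatching (I : Type v) (J : Type w) where
  coim : Set I
  im : Set J
  toEquiv : coim ≃ im

/-- Matched members are `ε`-interleaved with each other, and unmatched ones with zero. -/
structure PartialMatching.IsEpsMatching {I : Type v} {J : Type w} (h : PartialMatching I J)
    (ε : ℝ) (B : I → PersMod k n) (C : J → PersMod k n) : Prop where
  matched : ∀ i : h.coim, Interleaved ε (B i) (C (h.toEquiv i))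
  left : ∀ i, i ∉ h.coim → Interleaved ε (B i) (zeroModule k n)
  right : ∀ j, j ∉ h.im → Interleaved ε (C j) (zeroModule k n)

end HookStability

end

/-!
Stability of the barcodes of direct sums of hook modules under interleavings.

Since a morphism between hooks is a scalar, nonzero only if it raises neither parameter `i`, `j`,
a direct sum of hooks has a Krull-Schmidt property that can be proved by hand: an indecomposable
summand `B` admits a nonzero composite `L ⟶ B ⟶ L` for a hook `L` whose parameters are maximal in
the support of an element of `B`, so that `B` is isomorphic to `L`
(`Decomposition.isHook_of_retract`). Hence the given barcodes consist of hooks.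

An interleaving between `P` and `Q` is then a pair of matrices of scalars over the two barcodes.
Put `δ = (2n - 1)ε`, and call a hook short if it is `δ`-interleaved with zero. Order the hooks by
their weight, the sum of the `2n` coordinates of their parameters, with those of infinite death
last. If scalars `a → b[ε]` and `b → c[ε]` are nonzero and the weight does not drop from `a` to
`c`, then the parameters of `b` are within `δ` of those of `a` or of `c`
(`HookParam.close_or_close`), and the composite cannot vanish unless `a` or `c` is short
(`HookParam.short_or_short`). So for a finite set `A` of hooks of `P` that are not short, the
product of the two matrices through the set of hooks of `Q` that are `δ`-close to members of `A` is
unitriangular on `A`, and this set has at least `A.card` elements. The sets of close hooks are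
finite because `Q` is pointwise finite dimensional; Hall's theorem thus gives an injection of the
hooks of `P` that are not short into those of `Q` (`Decomposition.exists_injective_close`). By
symmetry there is one in the other direction, and Banach's mapping theorem
(`exists_partialMatching`) combines the two. Finally, hooks with `δ`-close parameters are
`δ`-interleaved by the canonical morphisms (`HookParam.Close.interleaved`).
-/

noncomputable section

/-! ### A rank estimate -/

/-- If the product through `N` of two matrices, restricted to `A`, is unitriangular for the order
given by a weight (entries between equal weights counting as diagonal), then `A` has at most as
many elements as `N`. -/
theorem Finset.card_le_card_of_unitriangular {K : Type*} [Field K] {I J α : Type*}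
    [LinearOrder α] [DecidableEq I] (wt : I → α) (A : Finset I) (N : Finset J)
    (W : I → J → K) (W' : J → I → K)
    (h : ∀ i ∈ A, ∀ i' ∈ A, wt i ≤ wt i' →
      ∑ c ∈ N, W' c i' * W i c = if i = i' then 1 else 0) : A.card ≤ N.card := by
  let L : (A → K) →ₗ[K] (N → K) :=
    { toFun := fun x c => ∑ i : A, W i c * x i
      map_add' := fun x y => by ext; simp [mul_add, Finset.sum_add_distrib]
      map_smul' := fun t x => by ext; simp [Finset.mul_sum, mul_left_comm] }
  have hL : Function.Injective L := by
    rw [injective_iff_map_eq_zero]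
    intro x hx
    by_contra hx0
    obtain ⟨i₀, hi₀⟩ := Function.ne_iff.1 hx0
    obtain ⟨m, hm, hmax⟩ := (Set.toFinite {i : A | x i ≠ 0}).exists_maximalFor
      (fun i : A => wt i) _ ⟨i₀, hi₀⟩
    -- Evaluate row `m` of `W' W x = 0`.
    have h0 : ∑ c : N, W' c m * L x c = 0 := by simp [hx]
    have h1 : ∑ c : N, W' c m * L x c = ∑ i : A, (∑ c ∈ N, W' c m * W i c) * x i := by
      simp only [L, LinearMap.coe_mk, AddHom.coe_mk, Finset.mul_sum, Finset.sum_mul]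
      rw [Finset.sum_comm]
      refine Finset.sum_congr rfl fun i _ => ?_
      rw [← Finset.sum_coe_sort N]
      exact Finset.sum_congr rfl fun c _ => (mul_assoc _ _ _).symm
    rw [h1, Finset.sum_eq_single m] at h0
    · rw [h m m.2 m m.2 le_rfl, if_pos rfl, one_mul] at h0
      exact hm h0
    · intro i _ him
      by_cases hxi : x i = 0
      · rw [hxi, mul_zero]
      · have hle : wt i ≤ wt m := (le_total (wt i) (wt m)).elim id fun h => hmax hxi h
        rw [h i i.2 m m.2 hle, if_neg (fun h => him (Subtype.ext h)), zero_mul]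
    · simp
  simpa using LinearMap.finrank_le_finrank_of_injective hL

namespace HookStability

universe u v w

variable {k : Type u} [Field k] {n : ℕ}

/-! ### Combining two injections -/

/-- Injections that match all of `S` and all of `T` along a relation `R` combine to one partial
matching along `R` that covers both (Banach's mapping theorem). -/
theorem exists_partialMatching {I : Type v} {J : Type w} (R : I → J → Prop) {S : Set I} {T : Set J}
    (f : S → J) (hf : Function.Injective f) (hfR : ∀ i : S, R i (f i))
    (g : T → I) (hg : Function.Injective g) (hgR : ∀ j : T, R (g j) j) :
    ∃ h : PartialMatching I J, (∀ i : h.coim, R i (h.toEquiv i)) ∧ S ⊆ h.coim ∧ T ⊆ h.im := by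
  -- `A` consists of the members of `S` outside `g (T \ f A)`, a fixed point condition, so that `f` on
  -- `A` and the inverse of `g` on `g (T \ f A)` are injections with disjoint domains and images.
  let Φ : Set S →o Set S :=
    ⟨fun A => {i | ∀ j : T, g j = i → ∃ i' ∈ A, f i' = j}, fun A A' hA i hi j hj =>
      let ⟨i', hi', h⟩ := hi j hj
      ⟨i', hA hi', h⟩⟩
  let A : Set S := Φ.lfp
  have hA : ∀ i, i ∈ A ↔ ∀ j : T, g j = i → ∃ i' ∈ A, f i' = j := fun i => by
    conv_lhs => rw [show A = Φ A from Φ.map_lfp.symm]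
    rfl
  let X := A ⊕ {j : T // ¬ ∃ i' ∈ A, f i' = j}
  let p : X → I := Sum.elim (fun i => i.1) (fun j => g j.1)
  let q : X → J := Sum.elim (fun i => f i.1) (fun j => j.1)
  have hp : Function.Injective p := by
    rintro (⟨i, hi⟩ | ⟨j, hj⟩) (⟨i', hi'⟩ | ⟨j', hj'⟩) h
    · exact congrArg Sum.inl (Subtype.ext (Subtype.ext h))
    · exact (hj' ((hA i).1 hi j' h.symm)).elim
    · exact (hj ((hA i').1 hi' j h)).elim
    · exact congrArg Sum.inr (Subtype.ext (hg h))
  have hq : Function.Injective q := by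
    rintro (⟨i, hi⟩ | ⟨j, hj⟩) (⟨i', hi'⟩ | ⟨j', hj'⟩) h
    · exact congrArg Sum.inl (Subtype.ext (hf h))
    · exact (hj' ⟨i, hi, h⟩).elim
    · exact (hj ⟨i', hi', h.symm⟩).elim
    · exact congrArg Sum.inr (Subtype.ext (Subtype.ext h))
  have hR : ∀ x, R (p x) (q x) := by
    rintro (i | j)
    · exact hfR _
    · exact hgR _
  refine ⟨⟨Set.range p, Set.range q,
    (Equiv.ofInjective p hp).symm.trans (Equiv.ofInjective q hq)⟩, ?_, ?_, ?_⟩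
  · rintro ⟨_, x, rfl⟩
    have : (Equiv.ofInjective p hp).symm ⟨p x, x, rfl⟩ = x := Equiv.ofInjective_symm_apply hp x
    simpa [this] using hR x
  · intro i hi
    by_cases h : (⟨i, hi⟩ : S) ∈ A
    · exact ⟨Sum.inl ⟨_, h⟩, rfl⟩
    · rw [hA] at h
      push Not at h
      obtain ⟨j, hj, h⟩ := h
      exact ⟨Sum.inr ⟨j, fun ⟨i', hi', h'⟩ => h i' hi' h'⟩, hj⟩
  · intro j hj
    by_cases h : ∃ i' ∈ A, f i' = j
    · obtain ⟨i, hi, h⟩ := h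
      exact ⟨Sum.inl ⟨i, hi⟩, h⟩
    · exact ⟨Sum.inr ⟨⟨j, hj⟩, h⟩, rfl⟩

/-! ### Decompositions -/

theorem app_map {M N : PersMod k n} (φ : M ⟶ N) {r s : RPow n} (h : r ⟶ s) (x : M.obj r) :
    (φ.app s).hom ((M.map h).hom x) = (N.map h).hom ((φ.app r).hom x) :=
  LinearMap.congr_fun (congrArg ModuleCat.Hom.hom (φ.naturality h)) x

/-- A direct sum decomposition of `P`, encoded by inclusions and projections. For infinite index
types, completeness means that every element of `P` is a finite sum of its components. -/
structure Decomposition {I : Type v} (M : I → PersMod k n) (P : PersMod k n) where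
  ι : ∀ i, M i ⟶ P
  π : ∀ i, P ⟶ M i
  ι_π_self : ∀ i, ι i ≫ π i = 𝟙 (M i)
  ι_π_ne : ∀ i j, i ≠ j → ι i ≫ π j = 0
  exists_sum : ∀ (r : RPow n) (x : P.obj r), ∃ F : Finset I,
    x = ∑ i ∈ F, ((ι i).app r).hom (((π i).app r).hom x)

open Classical in
theorem IsDirectSum.nonempty_decomposition {I : Type v} {M : I → PersMod k n} {P : PersMod k n}
    (h : IsDirectSum M P) : Nonempty (Decomposition M P) := by
  obtain ⟨ι, hι⟩ := h
  let E (r : RPow n) := LinearEquiv.ofBijective _ (hι r)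
  have hE (r : RPow n) (i : I) (x : (M i).obj r) :
      E r (DirectSum.lof k I (fun i => (M i).obj r) i x) = ((ι i).app r).hom x := by
    simp [E]
  have hE' (r : RPow n) (i : I) (x : (M i).obj r) :
      (E r).symm (((ι i).app r).hom x) = DirectSum.lof k I (fun i => (M i).obj r) i x := by
    rw [← hE, LinearEquiv.symm_apply_apply]
  have nat (i : I) (r s : RPow n) (f : r ⟶ s) (y : P.obj r) :
      (E s).symm ((P.map f).hom y) i = ((M i).map f).hom ((E r).symm y i) := by
    obtain ⟨z, rfl⟩ := (E r).surjective y
    induction z using DirectSum.induction_on with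
    | zero => simp
    | add a b ha hb => simp only [map_add, DirectSum.add_apply, ha, hb]
    | of j x =>
      have := hE r j x
      rw [DirectSum.lof_eq_of] at this
      rw [this, ← app_map, hE', hE', DirectSum.lof_eq_of, DirectSum.lof_eq_of]
      by_cases hij : j = i
      · subst hij; simp
      · rw [DirectSum.of_eq_of_ne _ _ _ (Ne.symm hij),
          DirectSum.of_eq_of_ne _ _ _ (Ne.symm hij), map_zero]
  refine ⟨⟨ι, fun i => ⟨fun r => ModuleCat.ofHom
      (DirectSum.component k I (fun i => (M i).obj r) i ∘ₗ (E r).symm.toLinearMap), ?_⟩,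
    ?_, ?_, ?_⟩⟩
  · intro r s f
    ext y
    exact nat i r s f y
  · intro i
    ext r x
    change (E r).symm (((ι i).app r).hom x) i = x
    rw [hE', DirectSum.lof_apply]
  · intro i j hij
    ext r x
    change (E r).symm (((ι i).app r).hom x) j = 0
    rw [hE', DirectSum.lof_eq_of, DirectSum.of_eq_of_ne _ _ _ (Ne.symm hij)]
  · intro r x
    refine ⟨DFinsupp.support ((E r).symm x), ?_⟩
    change x = ∑ i ∈ DFinsupp.support ((E r).symm x), ((ι i).app r).hom ((E r).symm x i)
    conv_lhs => rw [← (E r).apply_symm_apply x, ← DirectSum.sum_support_of ((E r).symm x), map_sum]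
    refine Finset.sum_congr rfl fun i _ => ?_
    rw [← DirectSum.lof_eq_of k, hE]

namespace Decomposition

variable {I : Type v} {M N : I → PersMod k n} {P : PersMod k n}

/-- Replace the summands of a decomposition by isomorphic ones. -/
def ofIso (D : Decomposition M P) (e : ∀ i, M i ≅ N i) : Decomposition N P where
  ι i := (e i).inv ≫ D.ι i
  π i := D.π i ≫ (e i).hom
  ι_π_self i := by simp [reassoc_of% D.ι_π_self i]
  ι_π_ne i j h := by simp [reassoc_of% D.ι_π_ne i j h]
  exists_sum r x := by
    obtain ⟨F, hF⟩ := D.exists_sum r x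
    refine ⟨F, hF.trans (Finset.sum_congr rfl fun i _ => ?_)⟩
    have := LinearMap.congr_fun (congrArg (fun φ : M i ⟶ M i => (φ.app r).hom)
      (e i).hom_inv_id) (((D.π i).app r).hom x)
    exact (congrArg ((D.ι i).app r).hom this).symm

variable (D : Decomposition M P)

theorem π_ι_self (i : I) (r : RPow n) (x : (M i).obj r) :
    ((D.π i).app r).hom (((D.ι i).app r).hom x) = x :=
  LinearMap.congr_fun (congrArg (fun φ : M i ⟶ M i => (φ.app r).hom) (D.ι_π_self i)) x

theorem π_ι_ne {i j : I} (h : i ≠ j) (r : RPow n) (x : (M i).obj r) :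
    ((D.π j).app r).hom (((D.ι i).app r).hom x) = 0 :=
  LinearMap.congr_fun (congrArg (fun φ : M i ⟶ M j => (φ.app r).hom) (D.ι_π_ne i j h)) x

/-- Every element is the sum of its components over a finite set that contains its support. -/
theorem exists_finset (r : RPow n) (x : P.obj r) : ∃ F : Finset I,
    x = ∑ i ∈ F, ((D.ι i).app r).hom (((D.π i).app r).hom x) ∧
    ∀ i ∉ F, ((D.π i).app r).hom x = 0 := by
  obtain ⟨F, hF⟩ := D.exists_sum r x
  refine ⟨F, hF, fun i hi => ?_⟩
  rw [hF, map_sum]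
  exact Finset.sum_eq_zero fun j hj => D.π_ι_ne (ne_of_mem_of_not_mem hj hi) _ _

end Decomposition

/-- A nonzero retract of an indecomposable module is the whole module. -/
theorem nonempty_iso_of_retract {L M : PersMod k n} (hM : Indecomposable M) (hL : ¬ Limits.IsZero L)
    (s : L ⟶ M) (p : M ⟶ L) (hsp : s ≫ p = 𝟙 L) : Nonempty (M ≅ L) := by
  let S : ShortComplex (PersMod k n) :=
    ShortComplex.mk s (Limits.cokernel.π s) (Limits.cokernel.condition s)
  have hS : S.Exact := ShortComplex.exact_cokernel s
  have : Epi S.g := inferInstanceAs (Epi (Limits.cokernel.π s))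
  let σ := ShortComplex.Splitting.ofExactOfRetraction S hS p hsp this
  have h0 : Limits.IsZero S.X₃ := (hM.2 _ _ σ.isoBinaryBiproduct).resolve_left hL
  have : Epi s := Preadditive.epi_of_isZero_cokernel s h0
  have : IsSplitMono s := ⟨⟨p, hsp⟩⟩
  have : IsIso s := isIso_of_epi_of_isSplitMono s
  exact ⟨(asIso s).symm⟩

/-! ### Morphisms between hooks -/

section HookHom

variable {i i' : RPow n} {j j' : WithTop (RPow n)}

theorem birth_mem_hookSet (h : (i : WithTop (RPow n)) < j) : i ∈ hookSet i j :=
  ⟨le_rfl, h.not_ge⟩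

/-- The element `1` of the interval module of `S` at a point of `S`. -/
def intervalOne (k : Type u) [Field k] {S : Set (RPow n)} {r : RPow n} (h : r ∈ S) :
    intervalSpace k S r :=
  ⟨1, fun h' => (h' h).elim⟩

theorem coe_intervalMap_of_mem {S : Set (RPow n)} {r s : RPow n} (h : s ∈ S)
    (x : intervalSpace k S r) : (intervalMap k S r s x : k) = x :=
  if_pos h

theorem coe_eq_zero_of_notMem {S : Set (RPow n)} {r : RPow n} (h : r ∉ S)
    (x : intervalSpace k S r) : (x : k) = 0 :=
  x.2 h

-- A morphism `L_{i,j} ⟶ σ^* L_{i',j'}` for a monotone reindexing `σ`, which is the identity or a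
-- shift below.
variable {σ : RPow n → RPow n} (hσ : Monotone σ)
  (φ : ∀ r, intervalSpace k (hookSet i j) r →ₗ[k] intervalSpace k (hookSet i' j') (σ r))
  (hφ : ∀ r s, r ≤ s → ∀ x, φ s (intervalMap k _ r s x) = intervalMap k _ (σ r) (σ s) (φ r x))

include hφ in
/-- A morphism out of a hook is multiplication by the image of the generator. -/
theorem coe_hookHom (hij : (i : WithTop (RPow n)) < j) {r : RPow n}
    (hr : σ r ∈ hookSet i' j') (x : intervalSpace k (hookSet i j) r) :
    (φ r x : k) = x * φ i (intervalOne k (birth_mem_hookSet hij)) := by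
  by_cases h : r ∈ hookSet i j
  · have hx : x = (x : k) • intervalMap k _ i r (intervalOne k (birth_mem_hookSet hij)) := by
      ext
      simp [coe_intervalMap_of_mem h, intervalOne]
    conv_lhs => rw [hx, map_smul, hφ i r h.1, Submodule.coe_smul, coe_intervalMap_of_mem hr]
    rfl
  · have hx : x = 0 := Subtype.ext (coe_eq_zero_of_notMem h x)
    simp [hx]

include hσ hφ in
/-- A nonzero morphism between hooks can only lower birth and death: the generator has an image,
and this image must vanish where the generator does. -/
theorem le_of_hookHom_ne_zero (hij : (i : WithTop (RPow n)) < j)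
    (h : (φ i (intervalOne k (birth_mem_hookSet hij)) : k) ≠ 0) :
    σ i ∈ hookSet i' j' ∧ j' ≤ WithTop.map σ j := by
  have hi : σ i ∈ hookSet i' j' := by
    by_contra hi
    exact h (coe_eq_zero_of_notMem hi _)
  refine ⟨hi, ?_⟩
  induction j using WithTop.recTopCoe with
  | top => exact le_top
  | coe j =>
    have hij' : i ≤ j := (WithTop.coe_lt_coe.1 hij).le
    rw [WithTop.map_coe]
    by_contra hj
    refine h ?_
    have hmem : σ j ∈ hookSet i' j' := ⟨hi.1.trans (hσ hij'), hj⟩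
    have h1 := congrArg Subtype.val (hφ i j hij' (intervalOne k (birth_mem_hookSet hij)))
    rw [coe_intervalMap_of_mem hmem] at h1
    have hz : intervalMap k (hookSet i j) i j (intervalOne k (birth_mem_hookSet hij)) = 0 :=
      Subtype.ext (coe_eq_zero_of_notMem (fun hj' => hj'.2 le_rfl) _)
    rw [← h1, hz, map_zero]
    rfl

end HookHom

/-- The parameters `i < j ≤ ∞` of a hook. -/
@[ext]
structure HookParam (n : ℕ) where
  birth : RPow n
  death : WithTop (RPow n)
  lt : (birth : WithTop (RPow n)) < death

namespace HookParam

/-- The points at which the hook module is nonzero. -/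
abbrev support (a : HookParam n) : Set (RPow n) := hookSet a.birth a.death

/-- The hook module with the given parameters. -/
abbrev module (k : Type u) [Field k] (a : HookParam n) : PersMod k n :=
  hookModule k a.birth a.death

theorem birth_mem (a : HookParam n) : a.birth ∈ a.support := birth_mem_hookSet a.lt

/-- The element `1` of a hook module at a point of its support. -/
def one (k : Type u) [Field k] (a : HookParam n) {r : RPow n} (h : r ∈ a.support) :
    (a.module k).obj r :=
  intervalOne k h

/-- The generator of a hook, an element of degree `birth`. -/
abbrev gen (k : Type u) [Field k] (a : HookParam n) : (a.module k).obj a.birth :=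
  a.one k a.birth_mem

theorem not_isZero (a : HookParam n) : ¬ Limits.IsZero (a.module k) := by
  intro h
  have h1 : 𝟙 (a.module k) = 0 := h.eq_of_src _ _
  have h2 := congrArg (fun φ : a.module k ⟶ a.module k => ((φ.app a.birth).hom (a.gen k)).1) h1
  exact one_ne_zero (α := k) h2

theorem coe_hom_apply {a b : HookParam n} (φ : a.module k ⟶ b.module k) {r : RPow n}
    (hr : r ∈ b.support) (x : (a.module k).obj r) :
    ((φ.app r).hom x).1 = x.1 * ((φ.app a.birth).hom (a.gen k)).1 :=
  coe_hookHom (σ := id) (fun r => (φ.app r).hom) (fun _ _ h x => app_map φ (homOfLE h) x) a.lt hr x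

/-- The case of `le_of_hookHom_ne_zero` without a shift. -/
theorem le_of_hom_ne_zero {a b : HookParam n} (φ : a.module k ⟶ b.module k) {r : RPow n}
    {x : (a.module k).obj r} (h : (φ.app r).hom x ≠ 0) :
    b.birth ≤ a.birth ∧ b.death ≤ a.death := by
  have hr : r ∈ b.support := by
    by_contra hr
    exact h (Subtype.ext (coe_eq_zero_of_notMem hr _))
  have h0 : ((φ.app a.birth).hom (a.gen k)).1 ≠ 0 := by
    intro h0
    refine h (Subtype.ext ?_)
    rw [coe_hom_apply φ hr, h0, mul_zero]
    rfl
  have := le_of_hookHom_ne_zero (σ := id) monotone_id (fun r => (φ.app r).hom)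
    (fun _ _ h x => app_map φ (homOfLE h) x) a.lt h0
  rw [WithTop.map_id] at this
  exact ⟨this.1.1, this.2⟩

/-- The endomorphism ring of a hook is the ground field. -/
theorem endo_eq_smul {a : HookParam n} (φ : a.module k ⟶ a.module k) :
    φ = ((φ.app a.birth).hom (a.gen k)).1 • 𝟙 (a.module k) := by
  ext r x
  by_cases hr : r ∈ a.support
  · refine Subtype.ext ((coe_hom_apply φ hr x).trans (mul_comm _ _))
  · exact Subtype.ext ((coe_eq_zero_of_notMem hr _).trans (coe_eq_zero_of_notMem hr _).symm)

end HookParam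

theorem isHook_iff {M : PersMod k n} :
    IsHook M ↔ ∃ a : HookParam n, Nonempty (M ≅ a.module k) :=
  ⟨fun ⟨i, j, h, e⟩ => ⟨⟨i, j, h⟩, e⟩, fun ⟨a, e⟩ => ⟨a.birth, a.death, a.lt, e⟩⟩

/-! ### Barcodes of sums of hooks -/

/-- Two hooks with the same parameters and a nonzero composite through an indecomposable module
`B` exhibit `B` as that hook. -/
theorem isHook_of_comp_ne_zero {a b : HookParam n} (hab : a = b) {B : PersMod k n}
    (hB : Indecomposable B) (φ : a.module k ⟶ B) (ψ : B ⟶ b.module k)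
    (h : φ ≫ ψ ≠ 0) : IsHook B := by
  subst hab
  have hc := HookParam.endo_eq_smul (φ ≫ ψ)
  set c := (((φ ≫ ψ).app a.birth).hom (a.gen k)).1
  have hc0 : c ≠ 0 := by
    intro h0
    rw [h0, zero_smul] at hc
    exact h hc
  refine isHook_iff.2 ⟨a, nonempty_iso_of_retract hB a.not_isZero φ (c⁻¹ • ψ) ?_⟩
  rw [Linear.comp_smul, hc, smul_smul, inv_mul_cancel₀ hc0, one_smul]

/-- Indecomposable summands of a direct sum of hooks are hooks. For a nonzero element `y` of the
summand `B`, choose a hook `b` in the support of `y` with maximal parameters. Since `y` is fixed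
by the projection to `B`, some hook in the support maps to `b` through `B` by a nonzero morphism;
as nonzero morphisms lower the parameters, this hook is isomorphic to `b`. -/
theorem Decomposition.isHook_of_retract {I : Type v} {a : I → HookParam n} {P : PersMod k n}
    (D : Decomposition (fun i => (a i).module k) P) {B : PersMod k n} (hB : Indecomposable B)
    (s : B ⟶ P) (p : P ⟶ B) (hsp : s ≫ p = 𝟙 B) : IsHook B := by
  obtain ⟨r, x, hx⟩ : ∃ (r : RPow n) (x : B.obj r), x ≠ 0 := by
    by_contra! h
    refine hB.1 ((Limits.IsZero.iff_id_eq_zero B).2 ?_)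
    ext r x
    exact (h r _).trans (h r _).symm
  have hpx : (p.app r).hom ((s.app r).hom x) = x :=
    LinearMap.congr_fun (congrArg (fun φ : B ⟶ B => (φ.app r).hom) hsp) x
  set y := (s.app r).hom x with hy
  obtain ⟨F, hF, hF0⟩ := D.exists_finset r y
  let S : Set I := {i | ((D.π i).app r).hom y ≠ 0}
  have hSfin : S.Finite := F.finite_toSet.subset fun i hi => by
    by_contra h
    exact hi (hF0 i h)
  have hS : S.Nonempty := by
    by_contra h
    rw [Set.not_nonempty_iff_eq_empty] at h
    refine hx ?_
    have hy0 : y = 0 := by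
      rw [hF]
      refine Finset.sum_eq_zero fun i _ => ?_
      have : ((D.π i).app r).hom y = 0 := by
        by_contra h'
        exact Set.notMem_empty i (h ▸ h')
      rw [this, map_zero]
    rw [← hpx, hy0, map_zero]
  obtain ⟨b, hb, hmax⟩ := hSfin.exists_maximalFor (fun i => ((a i).birth, (a i).death)) S hS
  have hyb : ((D.π b).app r).hom y =
      ∑ i ∈ F, ((D.π b).app r).hom ((s.app r).hom ((p.app r).hom
        (((D.ι i).app r).hom (((D.π i).app r).hom y)))) := by
    simp only [← map_sum]
    rw [← hF, hpx]
  obtain ⟨i, -, hi⟩ := Finset.exists_ne_zero_of_sum_ne_zero fun h => hb (hyb.trans h)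
  have hiS : i ∈ S := by
    intro h0
    rw [h0, map_zero, map_zero, map_zero, map_zero] at hi
    exact hi rfl
  let φ : (a i).module k ⟶ (a b).module k := (D.ι i ≫ p) ≫ (s ≫ D.π b)
  have hle := HookParam.le_of_hom_ne_zero φ (r := r) (x := ((D.π i).app r).hom y) hi
  have hle' := hmax hiS hle
  have hab : a i = a b :=
    HookParam.ext (hle'.1.antisymm hle.1) (hle'.2.antisymm hle.2)
  refine isHook_of_comp_ne_zero hab hB (D.ι i ≫ p) (s ≫ D.π b) fun h => hi ?_
  exact LinearMap.congr_fun (congrArg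
    (fun φ : (a i).module k ⟶ (a b).module k => (φ.app r).hom) h) (((D.π i).app r).hom y)

/-- The members of the barcode of a direct sum of hooks are hooks. -/
theorem IsBarcode.isHook {P : PersMod k n} (hP : IsCountablyHookDecomposable P) {I : Type v}
    {B : I → PersMod k n} (hB : IsBarcode P B) (i : I) : IsHook (B i) := by
  obtain ⟨J, -, M, hM, hMP⟩ := hP
  obtain ⟨D⟩ := hMP.nonempty_decomposition
  choose a ha using fun j => isHook_iff.1 (hM j)
  obtain ⟨D'⟩ := hB.2.nonempty_decomposition
  exact (D.ofIso fun j => (ha j).some).isHook_of_retract (hB.1 i) (D'.ι i) (D'.π i)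
    (D'.ι_π_self i)

/-! ### Numerical estimates -/

section Numeric

variable {ι : Type*} [Fintype ι] {ε : ℝ}

/-- If two successive steps raise no coordinate by more than `ε` and do not lower the total sum,
then in one of the steps no coordinate drops by more than `(m - 1)ε`, where `m` bounds the number
of coordinates. -/
theorem forall_le_or_forall_le_of_sum_le {x y z : ι → ℝ} {m : ℝ} (hm : Fintype.card ι ≤ m)
    (hε : 0 ≤ ε) (hxy : ∀ l, y l ≤ x l + ε) (hyz : ∀ l, z l ≤ y l + ε)
    (h : ∑ l, x l ≤ ∑ l, z l) :
    (∀ l, x l ≤ y l + (m - 1) * ε) ∨ ∀ l, y l ≤ z l + (m - 1) * ε := by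
  by_contra! hc
  obtain ⟨⟨l, hl⟩, l', hl'⟩ := hc
  have h1 : x l + ε - y l ≤ ∑ l, (x l + ε - y l) :=
    Finset.single_le_sum (f := fun l => x l + ε - y l) (fun l _ => by linarith [hxy l])
      (Finset.mem_univ l)
  have h2 : y l' + ε - z l' ≤ ∑ l, (y l + ε - z l) :=
    Finset.single_le_sum (f := fun l => y l + ε - z l) (fun l _ => by linarith [hyz l])
      (Finset.mem_univ l')
  simp only [Finset.sum_sub_distrib, Finset.sum_add_distrib, Finset.sum_const, Finset.card_univ,
    nsmul_eq_mul] at h1 h2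
  nlinarith [mul_le_mul_of_nonneg_right hm hε]

/-- Suppose that a step from `(b, d)` to `(b', d')` raises no coordinate by more than `2ε` and does
not lower the total sum. If `d'` is at most `b + 2ε`, then the gap between `b` and `d` or the one
between `b'` and `d'` is at most `2mε` in all coordinates. -/
theorem le_or_le_of_sum_le {b d b' d' : ι → ℝ} {m : ℝ} (hm : Fintype.card ι ≤ m)
    (hε : 0 ≤ ε) (hb : ∀ l, b' l ≤ b l + ε + ε) (hd : ∀ l, d' l ≤ d l + ε + ε)
    (h : ∑ l, b l + ∑ l, d l ≤ ∑ l, b' l + ∑ l, d' l) (hc : ∀ l, d' l ≤ b l + ε + ε) :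
    (∀ l, d l ≤ b l + 2 * m * ε) ∨ ∀ l, d' l ≤ b' l + 2 * m * ε := by
  by_contra! hcon
  obtain ⟨⟨l, hl⟩, l', hl'⟩ := hcon
  -- The drops, measured from `+2ε`, are nonnegative and add up to at most `4mε`. The gap `d - b` is
  -- a lower bound for the drop of `d`, and the gap `d' - b'` for that of `b`.
  have e1 : d l + ε + ε - d' l ≤ ∑ l, (d l + ε + ε - d' l) :=
    Finset.single_le_sum (f := fun l => d l + ε + ε - d' l)
      (fun l _ => by linarith [hd l]) (Finset.mem_univ l)
  have e2 : b l' + ε + ε - b' l' ≤ ∑ l, (b l + ε + ε - b' l) :=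
    Finset.single_le_sum (f := fun l => b l + ε + ε - b' l)
      (fun l _ => by linarith [hb l]) (Finset.mem_univ l')
  simp only [Finset.sum_sub_distrib, Finset.sum_add_distrib, Finset.sum_const,
    Finset.card_univ, nsmul_eq_mul] at e1 e2
  nlinarith [hc l, hc l', mul_le_mul_of_nonneg_right hm hε]

end Numeric

/-! ### Comparing the parameters of hooks -/

/-- The sum of the coordinates. -/
def RPow.total (x : RPow n) : ℝ := ∑ l, x l

/-- The weight by which hooks are ordered: those with infinite death come last, and otherwise the
sum of all coordinates of the finite parameters decides. -/
def HookParam.weight (a : HookParam n) : ℕ ×ₗ ℝ :=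
  match a.death with
  | ⊤ => toLex (1, a.birth.total)
  | (d : RPow n) => toLex (0, a.birth.total + d.total)

/-- The parameters of `a` and `b` differ by at most `δ` in each coordinate; in particular, an infinite
death is close to an infinite death only. -/
structure HookParam.Close (δ : ℝ) (a b : HookParam n) : Prop where
  birth_le : a.birth ≤ b.birth + RPow.const n δ
  le_birth : b.birth ≤ a.birth + RPow.const n δ
  death_le : a.death ≤ WithTop.map (· + RPow.const n δ) b.death
  le_death : b.death ≤ WithTop.map (· + RPow.const n δ) a.death

theorem HookParam.Close.symm {δ : ℝ} {a b : HookParam n} (h : a.Close δ b) : b.Close δ a :=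
  ⟨h.2, h.1, h.4, h.3⟩

/-- The death of `a` is at most its birth plus `δ`, so that the structure morphisms of degree `δ`
vanish. -/
def HookParam.Short (δ : ℝ) (a : HookParam n) : Prop :=
  a.death ≤ (a.birth + RPow.const n δ : RPow n)

/-- The parameters of `b` are at most those of `a` plus `ε`. -/
structure HookParam.Below (ε : ℝ) (b a : HookParam n) : Prop where
  birth : b.birth ≤ a.birth + RPow.const n ε
  death : b.death ≤ WithTop.map (· + RPow.const n ε) a.death

namespace HookParam

theorem Below.close {a b : HookParam n} {ε δ : ℝ} (hεδ : ε ≤ δ) (h : Below ε b a)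
    (hb : a.birth ≤ b.birth + RPow.const n δ)
    (hd : a.death ≤ WithTop.map (· + RPow.const n δ) b.death) : a.Close δ b := by
  refine ⟨hb, h.birth.trans fun l => add_le_add_right hεδ _, hd, h.death.trans ?_⟩
  cases a.death with
  | top => exact le_top
  | coe d => exact WithTop.coe_le_coe.2 fun l => add_le_add_right hεδ _

/-- If there are nonzero morphisms `a → b[ε]` and `b → c[ε]` and the weight does not drop from `a`
to `c`, then `b` is close to one of the ends. Here the constant `2n - 1` arises: there are at most
`2n` finite coordinates. -/
theorem close_or_close {ε : ℝ} (hε : 0 ≤ ε) (hn : 1 ≤ n) {a b c : HookParam n}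
    (hab : Below ε b a) (hbc : Below ε c b) (h : a.weight ≤ c.weight) :
    a.Close ((2 * (n : ℝ) - 1) * ε) b ∨ b.Close ((2 * (n : ℝ) - 1) * ε) c := by
  have hn' : (1 : ℝ) ≤ n := by exact_mod_cast hn
  have hεδ : ε ≤ (2 * (n : ℝ) - 1) * ε := by nlinarith
  have key : (a.birth ≤ b.birth + RPow.const n ((2 * (n : ℝ) - 1) * ε) ∧
        a.death ≤ WithTop.map (· + RPow.const n ((2 * (n : ℝ) - 1) * ε)) b.death) ∨
      (b.birth ≤ c.birth + RPow.const n ((2 * (n : ℝ) - 1) * ε) ∧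
        b.death ≤ WithTop.map (· + RPow.const n ((2 * (n : ℝ) - 1) * ε)) c.death) := by
    obtain ⟨ab, ad, alt⟩ := a
    obtain ⟨bb, bd, blt⟩ := b
    obtain ⟨cb, cd, clt⟩ := c
    obtain ⟨hab1, hab2⟩ := hab
    obtain ⟨hbc1, hbc2⟩ := hbc
    dsimp only at *
    cases ad with
    | top =>
      cases cd with
      | top =>
        cases bd with
        | coe d => simp at hbc2
        | top =>
          simp only [weight, Prod.Lex.toLex_le_toLex, lt_self_iff_false, true_and, false_or] at h
          refine (forall_le_or_forall_le_of_sum_le (m := 2 * n) (by simp; linarith) hε hab1 hbc1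
            h).imp (fun h => ⟨h, le_top⟩) (fun h => ⟨h, le_top⟩)
      | coe c' => simp [weight, Prod.Lex.toLex_le_toLex] at h
    | coe a' =>
      cases bd with
      | top => simp at hab2
      | coe b' =>
        cases cd with
        | top => simp at hbc2
        | coe c' =>
          simp only [weight, Prod.Lex.toLex_le_toLex, lt_self_iff_false, true_and, false_or] at h
          simp only [WithTop.map_coe, WithTop.coe_le_coe] at hab2 hbc2 ⊢
          have := forall_le_or_forall_le_of_sum_le (ι := Fin n ⊕ Fin n) (m := 2 * n)
            (x := Sum.elim ab a') (y := Sum.elim bb b') (z := Sum.elim cb c')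
            (by simp; linarith) hε (Sum.rec hab1 hab2) (Sum.rec hbc1 hbc2)
            (by rw [Fintype.sum_sum_type, Fintype.sum_sum_type]; exact h)
          simp only [Sum.forall] at this
          exact this
  exact key.imp (fun h => hab.close hεδ h.1 h.2) (fun h => hbc.close hεδ h.1 h.2)

/-- If the composite of nonzero morphisms `a → b[ε] → c[2ε]` vanishes although the weight does not
drop from `a` to `c`, then one of the ends is short. -/
theorem short_or_short {ε : ℝ} (hε : 0 ≤ ε) (hn : 1 ≤ n) {a b c : HookParam n}
    (hab : Below ε b a) (hbc : Below ε c b) (h : a.weight ≤ c.weight)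
    (hc : c.death ≤ (a.birth + RPow.const n ε + RPow.const n ε : RPow n)) :
    a.Short (2 * ((2 * (n : ℝ) - 1) * ε)) ∨ c.Short (2 * ((2 * (n : ℝ) - 1) * ε)) := by
  have hn' : (1 : ℝ) ≤ n := by exact_mod_cast hn
  obtain ⟨ab, ad, alt⟩ := a
  obtain ⟨bb, bd, blt⟩ := b
  obtain ⟨cb, cd, clt⟩ := c
  obtain ⟨hab1, hab2⟩ := hab
  obtain ⟨hbc1, hbc2⟩ := hbc
  unfold Short
  dsimp only at *
  cases cd with
  | top => simp at hc
  | coe c' =>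
    cases ad with
    | top => simp [weight, Prod.Lex.toLex_le_toLex] at h
    | coe a' =>
      cases bd with
      | top => simp at hab2
      | coe b' =>
        simp only [weight, Prod.Lex.toLex_le_toLex, lt_self_iff_false, true_and, false_or] at h
        simp only [WithTop.map_coe, WithTop.coe_le_coe] at hab2 hbc2 hc ⊢
        have := le_or_le_of_sum_le (m := n) (b := ab) (d := a') (b' := cb) (d' := c') (by simp) hε
          (fun l => (hbc1 l).trans (add_le_add_left (hab1 l) ε))
          (fun l => (hbc2 l).trans (add_le_add_left (hab2 l) ε)) h hc
        have hle : 2 * n * ε ≤ 2 * ((2 * (n : ℝ) - 1) * ε) := by nlinarith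
        exact this.imp (fun h l => (h l).trans (add_le_add_right hle _))
          (fun h l => (h l).trans (add_le_add_right hle _))

end HookParam

/-! ### The matrices of an interleaving -/

/-- The shift `φ[v]` of a morphism. -/
def shiftMap (v : RPow n) {M N : PersMod k n} (φ : M ⟶ N) : shift v M ⟶ shift v N where
  app r := φ.app (r + v)
  naturality _ _ _ := φ.naturality _

namespace HookParam

/-- The underlying scalar of an element of a hook. -/
def val (a : HookParam n) (r : RPow n) : (a.module k).obj r →ₗ[k] k :=
  Submodule.subtype (intervalSpace k a.support r)

theorem val_injective (a : HookParam n) (r : RPow n) :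
    Function.Injective (a.val r : (a.module k).obj r →ₗ[k] k) :=
  Subtype.val_injective

theorem val_eq_zero (a : HookParam n) {r : RPow n} (hr : r ∉ a.support)
    (x : (a.module k).obj r) : a.val r x = 0 :=
  coe_eq_zero_of_notMem hr x

theorem val_gen (a : HookParam n) : a.val a.birth (a.gen k) = 1 := rfl

theorem val_map {a : HookParam n} {r s : RPow n} (h : r ⟶ s) (hs : s ∈ a.support)
    (x : (a.module k).obj r) : a.val s (((a.module k).map h).hom x) = a.val r x :=
  coe_intervalMap_of_mem hs x

variable {a b : HookParam n} {v : RPow n}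

/-- The scalar by which a morphism to a shifted hook multiplies. It is zero if the birth of `a`,
shifted by `v`, is outside the support of `b`. -/
def coeff (φ : a.module k ⟶ shift v (b.module k)) : k :=
  b.val _ ((φ.app a.birth).hom (a.gen k))

theorem val_hom_apply (φ : a.module k ⟶ shift v (b.module k)) {r : RPow n}
    (hr : r + v ∈ b.support) (x : (a.module k).obj r) :
    b.val _ ((φ.app r).hom x) = a.val _ x * coeff φ :=
  coe_hookHom (σ := (· + v)) (fun r => (φ.app r).hom) (fun _ _ h x => app_map φ (homOfLE h) x)
    a.lt hr x

theorem below_of_coeff_ne_zero {ε : ℝ} (φ : a.module k ⟶ shift (RPow.const n ε) (b.module k))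
    (h : coeff φ ≠ 0) : Below ε b a := by
  have := le_of_hookHom_ne_zero (σ := (· + RPow.const n ε)) (fun _ _ h => add_le_add_left h _)
    (fun r => (φ.app r).hom) (fun _ _ h x => app_map φ (homOfLE h) x) a.lt h
  exact ⟨this.1.1, this.2⟩

end HookParam

namespace Decomposition

variable {I : Type v} {J : Type w} {a : I → HookParam n} {b : J → HookParam n} {P Q : PersMod k n}
  (D : Decomposition (fun i => (a i).module k) P) (E : Decomposition (fun i => (b i).module k) Q)

include E in
/-- At each point only finitely many of the hooks in a pointwise finite dimensional module are
nonzero. -/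
theorem finite_setOf_mem_support (hQ : IsPFD Q) (r : RPow n) :
    {c | r ∈ (b c).support}.Finite := by
  have := hQ r
  let e (c : {c | r ∈ (b c).support}) : Q.obj r :=
    ((E.ι c.1).app r).hom ((b c.1).one k c.2)
  have he : LinearIndependent k e := by
    rw [linearIndependent_iff']
    intro F g hg c hc
    have h := congrArg (fun x => (b c).val r (((E.π c.1).app r).hom x)) hg
    simp only [map_sum, map_smul, map_zero] at h
    rw [Finset.sum_eq_single_of_mem c hc] at h
    · dsimp only [e] at h
      rw [E.π_ι_self] at h
      exact (mul_one (g c)).symm.trans h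
    · intro c' _ hc'
      dsimp only [e]
      rw [E.π_ι_ne (fun h => hc' (Subtype.ext h)), map_zero, smul_zero]
  have := he.finite
  exact Set.toFinite _

/-- The entry at `(i, c)` of the matrix of a morphism of degree `v` between sums of hooks. -/
def entry {v : RPow n} (f : P ⟶ shift v Q) (i : I) (c : J) : k :=
  HookParam.coeff (D.ι i ≫ f ≫ shiftMap v (E.π c))

theorem val_component {v : RPow n} (f : P ⟶ shift v Q) (i : I) (c : J) :
    (b c).val _ (((E.π c).app _).hom ((f.app _).hom (((D.ι i).app _).hom ((a i).gen k)))) =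
      D.entry E f i c := rfl

/-- The matrix product of the two morphisms of an interleaving is the identity, in those entries
where the structure morphism of degree `2v` may be nonzero. -/
theorem sum_entry_mul_entry {v : RPow n} (hv : 0 ≤ v) (f : P ⟶ shift v Q) (g : Q ⟶ shift v P)
    (hfg : ∀ r : RPow n, f.app r ≫ g.app (r + v) =
      P.map (homOfLE ((le_add_of_nonneg_right hv).trans (le_add_of_nonneg_right hv))))
    (i i' : I) (hi : (a i).birth + v + v ∈ (a i').support) (F : Finset J)
    (hF : ∀ c, D.entry E f i c ≠ 0 → E.entry D g c i' ≠ 0 → c ∈ F) [Decidable (i = i')] :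
    ∑ c ∈ F, E.entry D g c i' * D.entry E f i c = if i = i' then 1 else 0 := by
  set x := ((D.ι i).app (a i).birth).hom ((a i).gen k) with hx
  set y := (f.app (a i).birth).hom x with hy
  obtain ⟨G, hG, hG0⟩ := E.exists_finset _ y
  have hgy : (g.app _).hom y = (P.map (homOfLE ((le_add_of_nonneg_right hv).trans
      (le_add_of_nonneg_right hv)))).hom x :=
    LinearMap.congr_fun (congrArg ModuleCat.Hom.hom (hfg (a i).birth)) x
  have hlhs : (a i').val _ (((D.π i').app _).hom ((g.app _).hom y)) =
      if i = i' then 1 else 0 := by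
    rw [hgy, app_map, HookParam.val_map _ hi]
    split_ifs with h
    · subst h
      rw [hx, D.π_ι_self, HookParam.val_gen]
    · rw [hx, D.π_ι_ne h, map_zero]
  have hterm (c : J) : (a i').val _ (((D.π i').app _).hom ((g.app _).hom
      (((E.ι c).app _).hom (((E.π c).app _).hom y)))) =
      E.entry D g c i' * D.entry E f i c :=
    (HookParam.val_hom_apply (E.ι c ≫ g ≫ shiftMap v (D.π i')) hi _).trans (mul_comm _ _)
  rw [hG] at hlhs
  simp only [map_sum, hterm] at hlhs
  rw [← hlhs]
  classical
  have h1 : ∑ c ∈ F, E.entry D g c i' * D.entry E f i c =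
      ∑ c ∈ F ∪ G, E.entry D g c i' * D.entry E f i c := by
    refine Finset.sum_subset Finset.subset_union_left fun c _ hc => ?_
    by_contra h
    exact hc (hF c (right_ne_zero_of_mul h) (left_ne_zero_of_mul h))
  have h2 : ∑ c ∈ G, E.entry D g c i' * D.entry E f i c =
      ∑ c ∈ F ∪ G, E.entry D g c i' * D.entry E f i c := by
    refine Finset.sum_subset Finset.subset_union_right fun c _ hc => ?_
    rw [← D.val_component, hG0 c hc, map_zero, mul_zero]
  rw [h1, h2]

include D E in
/-- Half of the matching. By Hall's theorem it is enough that a finite set `A` of hooks that are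
not short has at least as many neighbours. The columns of the matrix of `f` at `A` satisfy a
unitriangular relation in which only neighbours of `A` take part. -/
theorem exists_injective_close {ε : ℝ} (hε : 0 ≤ ε) (hn : 1 ≤ n) (hQ : IsPFD Q)
    (f : P ⟶ shift (RPow.const n ε) Q) (g : Q ⟶ shift (RPow.const n ε) P)
    (hfg : ∀ r : RPow n, f.app r ≫ g.app (r + RPow.const n ε) =
      P.map (homOfLE ((le_add_of_nonneg_right (RPow.const_nonneg hε)).trans
        (le_add_of_nonneg_right (RPow.const_nonneg hε))))) :
    ∃ m : {i | ¬ (a i).Short (2 * ((2 * (n : ℝ) - 1) * ε))} → J, Function.Injective m ∧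
      ∀ i : {i | ¬ (a i).Short (2 * ((2 * (n : ℝ) - 1) * ε))},
        (a i).Close ((2 * (n : ℝ) - 1) * ε) (b (m i)) := by
  classical
  have hn' : (1 : ℝ) ≤ n := by exact_mod_cast hn
  set δ := (2 * (n : ℝ) - 1) * ε with hδ
  have hεδ : ε ≤ δ := by nlinarith
  have hfin (i : {i | ¬ (a i).Short (2 * δ)}) : {c | (a i).Close δ (b c)}.Finite := by
    refine (E.finite_setOf_mem_support hQ ((a i).birth + RPow.const n δ)).subset fun c hc =>
      ⟨hc.le_birth, fun h => i.2 (hc.death_le.trans ?_)⟩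
    revert h
    cases (b c).death with
    | top => simp
    | coe d =>
      intro h
      refine WithTop.coe_le_coe.2 fun l => ?_
      have : d l ≤ (a i).birth l + δ := WithTop.coe_le_coe.1 h l
      change d l + δ ≤ (a i).birth l + 2 * δ
      linarith
  let t (i : {i | ¬ (a i).Short (2 * δ)}) : Finset J := (hfin i).toFinset
  have ht (i : {i | ¬ (a i).Short (2 * δ)}) (c : J) : c ∈ t i ↔ (a i).Close δ (b c) :=
    (hfin i).mem_toFinset
  obtain ⟨m, hm, hmt⟩ := (Finset.all_card_le_biUnion_card_iff_exists_injective t).1 fun A => by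
    refine Finset.card_le_card_of_unitriangular (I := {i | ¬ (a i).Short (2 * δ)})
      (fun i => (a i).weight) A (A.biUnion t)
      (fun i => D.entry E f i) (fun c i => E.entry D g c i) fun i hi i' hi' hw => ?_
    have hmem (c : J) (h1 : D.entry E f i c ≠ 0) (h2 : E.entry D g c i' ≠ 0) :
        c ∈ A.biUnion t := by
      rw [Finset.mem_biUnion]
      obtain h | h := HookParam.close_or_close hε hn (HookParam.below_of_coeff_ne_zero _ h1)
        (HookParam.below_of_coeff_ne_zero _ h2) hw
      · exact ⟨i, hi, (ht _ _).2 h⟩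
      · exact ⟨i', hi', (ht _ _).2 h.symm⟩
    by_cases hs : (a i).birth + RPow.const n ε + RPow.const n ε ∈ (a i').support
    · have := D.sum_entry_mul_entry E (RPow.const_nonneg hε) f g hfg i i' hs (A.biUnion t) hmem
      simpa only [Subtype.ext_iff] using this
    · have hii : i ≠ i' := by
        rintro rfl
        refine hs ⟨fun l => ?_, fun h => i.2 (h.trans (WithTop.coe_le_coe.2 fun l => ?_))⟩
        · change (a i).birth l ≤ (a i).birth l + ε + ε
          linarith
        · change (a i).birth l + ε + ε ≤ (a i).birth l + 2 * δ
          linarith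
      rw [if_neg hii]
      refine Finset.sum_eq_zero fun c _ => ?_
      by_contra h0
      have h1 := HookParam.below_of_coeff_ne_zero _ (right_ne_zero_of_mul h0)
      have h2 := HookParam.below_of_coeff_ne_zero _ (left_ne_zero_of_mul h0)
      have hd : (a i').death ≤ ((a i).birth + RPow.const n ε + RPow.const n ε : RPow n) := by
        by_contra hd
        exact hs ⟨h2.birth.trans (add_le_add_left h1.birth _), hd⟩
      exact (HookParam.short_or_short hε hn h1 h2 hw hd).elim i.2 i'.2
  exact ⟨m, hm, fun i => (ht _ _).1 (hmt i)⟩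

end Decomposition

/-! ### Interleavings of hooks -/

namespace HookParam

open Classical in
/-- The canonical morphism between hooks, the identity of `k` wherever both are nonzero. -/
def canonicalHom (k : Type u) [Field k] {a b : HookParam n} {δ : ℝ} (h : Below δ b a) :
    a.module k ⟶ shift (RPow.const n δ) (b.module k) where
  app r := ModuleCat.ofHom (X := intervalSpace k a.support r)
    (Y := intervalSpace k b.support (r + RPow.const n δ))
    { toFun := fun x => ⟨if r + RPow.const n δ ∈ b.support then (x : k) else 0,
        fun h => by rw [if_neg h]⟩
      map_add' := fun x y => by
        ext
        by_cases h : r + RPow.const n δ ∈ b.support <;> simp [h]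
      map_smul' := fun c x => by
        ext
        by_cases h : r + RPow.const n δ ∈ b.support <;> simp [h] }
  naturality r s hrs := by
    ext x
    refine b.val_injective (k := k) _ ?_
    by_cases hs : s + RPow.const n δ ∈ b.support
    · by_cases hr : r ∈ a.support
      · have hs' : s ∈ a.support := by
          refine ⟨hr.1.trans (leOfHom hrs), fun h' => hs.2 (h.death.trans ?_)⟩
          revert h'
          cases a.death with
          | top => simp
          | coe d => exact fun h' => WithTop.coe_le_coe.2 fun l =>
              add_le_add_left (WithTop.coe_le_coe.1 h' l) δ
        have hr' : r + RPow.const n δ ∈ b.support :=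
          ⟨h.birth.trans (add_le_add_left hr.1 _), fun h' =>
            hs.2 (h'.trans (WithTop.coe_le_coe.2 (add_le_add_left (leOfHom hrs) _)))⟩
        refine (if_pos hs).trans ((val_map hrs hs' x).trans ?_)
        exact ((val_map (homOfLE (add_le_add_left (leOfHom hrs) _)) hs _).trans (if_pos hr')).symm
      · have hx : x = 0 := a.val_injective (k := k) _ ((a.val_eq_zero hr x).trans (map_zero _).symm)
        rw [hx]
        simp only [map_zero]
    · exact (b.val_eq_zero hs _).trans (b.val_eq_zero hs _).symm

theorem val_canonicalHom_apply {a b : HookParam n} {δ : ℝ} (h : Below δ b a) {r : RPow n}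
    (hr : r + RPow.const n δ ∈ b.support) (x : (a.module k).obj r) :
    b.val _ (((canonicalHom k h).app r).hom x) = a.val r x :=
  if_pos hr

/-- Both composites of the canonical morphisms are structure morphisms, since a point of `a`
whose shift by `2δ` is in `a` has its shift by `δ` in `b`. -/
theorem canonicalHom_comp {a b : HookParam n} {δ : ℝ} (hδ : 0 ≤ δ) (h : a.Close δ b) (r : RPow n) :
    (canonicalHom k ⟨h.le_birth, h.le_death⟩).app r ≫
        (canonicalHom k ⟨h.birth_le, h.death_le⟩).app (r + RPow.const n δ) =
      (a.module k).map (homOfLE ((le_add_of_nonneg_right (RPow.const_nonneg hδ)).trans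
        (le_add_of_nonneg_right (RPow.const_nonneg hδ)))) := by
  ext x
  refine a.val_injective (k := k) _ ?_
  by_cases hr : r ∈ a.support
  · by_cases hr2 : r + RPow.const n δ + RPow.const n δ ∈ a.support
    · have hr1 : r + RPow.const n δ ∈ b.support := by
        refine ⟨h.le_birth.trans (add_le_add_left hr.1 _), fun h' => hr2.2 (h.death_le.trans ?_)⟩
        revert h'
        cases b.death with
        | top => simp
        | coe d => exact fun h' => WithTop.coe_le_coe.2 fun l =>
            add_le_add_left (WithTop.coe_le_coe.1 h' l) δ
      exact ((val_canonicalHom_apply ⟨h.birth_le, h.death_le⟩ hr2 _).trans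
        (val_canonicalHom_apply _ hr1 x)).trans (val_map _ hr2 x).symm
    · exact (a.val_eq_zero hr2 _).trans (a.val_eq_zero hr2 _).symm
  · have hx : x = 0 := a.val_injective (k := k) _ ((a.val_eq_zero hr x).trans (map_zero _).symm)
    rw [hx]
    simp only [map_zero]

theorem Close.interleaved {a b : HookParam n} {δ : ℝ} (hδ : 0 ≤ δ) (h : a.Close δ b) :
    Interleaved δ (a.module k) (b.module k) :=
  ⟨hδ, canonicalHom k ⟨h.le_birth, h.le_death⟩, canonicalHom k ⟨h.birth_le, h.death_le⟩,
    canonicalHom_comp hδ h, canonicalHom_comp hδ h.symm⟩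

theorem Short.interleaved {a : HookParam n} {δ : ℝ} (hδ : 0 ≤ δ) (h : a.Short (2 * δ)) :
    Interleaved δ (a.module k) (zeroModule k n) := by
  refine ⟨hδ, 0, 0, fun r => ?_, fun r => ?_⟩
  · ext x
    have : r + RPow.const n δ + RPow.const n δ ∉ a.support ∨ r ∉ a.support := by
      by_contra! hc
      refine hc.1.2 (h.trans (WithTop.coe_le_coe.2 fun l => ?_))
      have : a.birth l ≤ r l := hc.2.1 l
      change a.birth l + 2 * δ ≤ r l + δ + δ
      linarith
    refine a.val_injective (k := k) _ ?_
    obtain hr | hr := this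
    · exact (a.val_eq_zero hr _).trans (a.val_eq_zero hr _).symm
    · have hx : x = 0 := a.val_injective (k := k) _ ((a.val_eq_zero hr x).trans (map_zero _).symm)
      rw [hx]
      simp only [map_zero]
  · ext x
    rfl

end HookParam

theorem Interleaved.of_iso {ε : ℝ} {M M' N N' : PersMod k n} (e : M ≅ M') (e' : N ≅ N')
    (h : Interleaved ε M' N') : Interleaved ε M N := by
  obtain ⟨hε, f, g, hfg, hgf⟩ := h
  refine ⟨hε, e.hom ≫ f ≫ shiftMap _ e'.inv, e'.hom ≫ g ≫ shiftMap _ e.inv,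
    fun r => ?_, fun r => ?_⟩
  · change (e.hom.app r ≫ f.app r ≫ e'.inv.app _) ≫ e'.hom.app _ ≫ g.app _ ≫ e.inv.app _ = _
    simp only [Category.assoc, Iso.inv_hom_id_app_assoc]
    rw [reassoc_of% hfg r, e.inv.naturality, Iso.hom_inv_id_app_assoc]
  · change (e'.hom.app r ≫ g.app r ≫ e.inv.app _) ≫ e.hom.app _ ≫ f.app _ ≫ e'.inv.app _ = _
    simp only [Category.assoc, Iso.inv_hom_id_app_assoc]
    rw [reassoc_of% hgf r, e'.inv.naturality, Iso.hom_inv_id_app_assoc]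

end HookStability

end

theorem mainTheorem3 {k : Type*} [Field k] {n : ℕ} (hn : 1 ≤ n)
    (P Q : HookStability.PersMod k n)
    (hP : HookStability.IsPFD P) (hQ : HookStability.IsPFD Q)
    (hP' : HookStability.IsCountablyHookDecomposable P)
    (hQ' : HookStability.IsCountablyHookDecomposable Q)
    (ε : ℝ) (hε : 0 ≤ ε) (hPQ : HookStability.Interleaved ε P Q)
    {I : Type*} {J : Type*}
    (B : I → HookStability.PersMod k n) (C : J → HookStability.PersMod k n)
    (hB : HookStability.IsBarcode P B) (hC : HookStability.IsBarcode Q C) :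
    ∃ h : HookStability.PartialMatching I J, h.IsEpsMatching ((2 * (n : ℝ) - 1) * ε) B C := by
  choose a ha using fun i => HookStability.isHook_iff.1 (hB.isHook hP' i)
  choose b hb using fun j => HookStability.isHook_iff.1 (hC.isHook hQ' j)
  obtain ⟨D⟩ := hB.2.nonempty_decomposition
  obtain ⟨E⟩ := hC.2.nonempty_decomposition
  let D' := D.ofIso fun i => (ha i).some
  let E' := E.ofIso fun j => (hb j).some
  obtain ⟨_, f, g, hfg, hgf⟩ := hPQ
  obtain ⟨m, hm, hmc⟩ := D'.exists_injective_close E' hε hn hQ f g hfg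
  obtain ⟨m', hm', hmc'⟩ := E'.exists_injective_close D' hε hn hP g f hgf
  obtain ⟨h, hmatch, hleft, hright⟩ := HookStability.exists_partialMatching
    (fun i j => (a i).Close ((2 * (n : ℝ) - 1) * ε) (b j)) m hm hmc m' hm'
    (fun j => (hmc' j).symm)
  have hn' : (1 : ℝ) ≤ n := by exact_mod_cast hn
  have hδ : 0 ≤ (2 * (n : ℝ) - 1) * ε := mul_nonneg (by linarith) hε
  refine ⟨h, fun i => ?_, fun i hi => ?_, fun j hj => ?_⟩
  · exact ((hmatch i).interleaved hδ).of_iso (ha i).some (hb _).some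
  · exact (HookStability.HookParam.Short.interleaved hδ (not_not.1 fun hs => hi (hleft hs))).of_iso
      (ha i).some (Iso.refl _)
  · exact (HookStability.HookParam.Short.interleaved hδ (not_not.1 fun hs => hj (hright hs))).of_iso
      (hb j).some (Iso.refl _)
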